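/- There is a universal constant $c_1>0$ such that for every $C>0$ there is a constant $\gamma>0$, depending only on $C$, such that for every $c_2\ge c_1$ there are constants $K,c>0$, depending only on $C$ and $c_2$, with the following property. Let $G:\mathbb{R}^k\to\mathbb{R}^n$ be computed by a feedforward network with $d\ge 1$ layers, each of the form $x\mapsto\mathrm{relu}(Wx+\beta)$, where $\mathrm{relu}(x)_i=\max(x_i,0)$ and each layer has at most $n$ neurons (the rectifier may be omitted in the output layer). Let $A\in\mathbb{R}^{m\times n}$ be a random matrix with i.i.d. rows $a_1,\dots,a_m$ that are isotropic, $\mathbb{E}\langle a_i,u\rangle^2=\|u\|^2$ for all $u\in\mathbb{R}^n$, and heavy-tailed with constant $C$: the fourth moments are finite and $$\left(\mathbb{E}\langle a_i,u\rangle^4\right)^{1/4}\le C\left(\mathbb{E}\langle a_i,u\rangle^2\right)^{1/2}\qquad\text{for all }u\in\mathbb{R}^n .$$ Let $[m]$ be partitioned into $M$ disjoint batches $B_1,\dots,B_M$ of size $b$ each, where $c_1C^4\le b\le c_2C^4$ and $M\ge K\,k\,d\log n$, and let $A_{B_j}\in\mathbb{R}^{b\times n}$ be the submatrix of $A$ formed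 by the rows in $B_j$. Then with probability at least $1-e^{-cm}$, for all $z_1,z_2\in\mathbb{R}^k$ there is a set $J\subseteq[M]$ with $|J|\ge 0.9M$ such that $$\frac1b\left\|A_{B_j}\bigl(G(z_1)-G(z_2)\bigr)\right\|^2\ \ge\ \gamma^2\left\|G(z_1)-G(z_2)\right\|^2\qquad\text{for all }j\in J ,$$ where $\|\cdot\|$ is the Euclidean norm. -/

import Mathlib

open MeasureTheory ProbabilityTheory

noncomputable section

/-- `ℝⁿ` with the Euclidean norm. -/
abbrev Vec (n : ℕ) : Type := EuclideanSpace ℝ (Fin n)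

/-- The coordinatewise rectifier `x ↦ max(x, 0)`. -/
def relu {n : ℕ} (x : Vec n) : Vec n :=
  WithLp.toLp 2 fun i => max (x i) 0

/-- The affine map `x ↦ W x + β`. -/
def affineLayer {k n : ℕ} (W : Matrix (Fin n) (Fin k) ℝ) (β : Vec n) (x : Vec k) : Vec n :=
  Matrix.toEuclideanLin W x + β

/-- `IsReLUNetwork w d k n G`: the map `G : ℝᵏ → ℝⁿ` is computed by a feedforward network with
`d` layers, each an affine map followed by the rectifier, whose hidden layers have at most `w`
neurons each. The rectifier may be left out in the output layer. -/
inductive IsReLUNetwork (w : ℕ) : (d k n : ℕ) → (Vec k → Vec n) → Prop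
  | reluOutput {k n : ℕ} (W : Matrix (Fin n) (Fin k) ℝ) (β : Vec n) :
      IsReLUNetwork w 1 k n (fun z => relu (affineLayer W β z))
  | affineOutput {k n : ℕ} (W : Matrix (Fin n) (Fin k) ℝ) (β : Vec n) :
      IsReLUNetwork w 1 k n (fun z => affineLayer W β z)
  | hidden {d k l n : ℕ} (hl : l ≤ w) (W : Matrix (Fin l) (Fin k) ℝ) (β : Vec l)
      (F : Vec l → Vec n) (hF : IsReLUNetwork w d l n F) :
      IsReLUNetwork w (d + 1) k n (fun z => F (relu (affineLayer W β z)))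

/-- The random vector `a` has finite fourth moments and
`(𝔼⟨a,u⟩⁴)^(1/4) ≤ C (𝔼⟨a,u⟩²)^(1/2)` for every vector `u`. -/
def IsHeavyTailed {Ω : Type*} [MeasurableSpace Ω] {n : ℕ} (μ : Measure Ω) (a : Ω → Vec n)
    (C : ℝ) : Prop :=
  ∀ u : Vec n, MemLp (fun ω => inner ℝ (a ω) u) 4 μ ∧
    (∫ ω, (inner ℝ (a ω) u) ^ 4 ∂μ) ^ (1 / 4 : ℝ) ≤
      C * (∫ ω, (inner ℝ (a ω) u) ^ 2 ∂μ) ^ (1 / 2 : ℝ)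

/-- The random vector `a` is isotropic: `𝔼⟨a,u⟩² = ‖u‖²` for every `u`, i.e. `𝔼 a aᵀ = I`. -/
def IsIsotropic {Ω : Type*} [MeasurableSpace Ω] {n : ℕ} (μ : Measure Ω) (a : Ω → Vec n) : Prop :=
  ∀ u : Vec n, MemLp (fun ω => inner ℝ (a ω) u) 2 μ ∧
    ∫ ω, (inner ℝ (a ω) u) ^ 2 ∂μ = ‖u‖ ^ 2

/-- The `i`-th row of the matrix `A` as a vector of `ℝⁿ`. -/
def rowVec {m n : ℕ} (A : Matrix (Fin m) (Fin n) ℝ) (i : Fin m) : Vec n :=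
  WithLp.toLp 2 (A i)

/-- The random matrix `A` has independent, identically distributed rows, and each row is
isotropic and heavy-tailed with moment constant `C`. -/
structure IsHeavyTailedMatrix {Ω : Type*} [MeasurableSpace Ω] {m n : ℕ} (μ : Measure Ω)
    (A : Ω → Matrix (Fin m) (Fin n) ℝ) (C : ℝ) : Prop where
  measurable_row : ∀ i, Measurable fun ω => rowVec (A ω) i
  indep : iIndepFun (fun i ω => rowVec (A ω) i) μ
  identDistrib : ∀ i j, IdentDistrib (fun ω => rowVec (A ω) i) (fun ω => rowVec (A ω) j) μ μ
  isotropic : ∀ i, IsIsotropic μ fun ω => rowVec (A ω) i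
  heavyTailed : ∀ i, IsHeavyTailed μ (fun ω => rowVec (A ω) i) C

/-- `B₁, …, B_M` is a partition of the `m` row indices into `M` batches of size `b`. -/
structure IsBatching {m M : ℕ} (b : ℕ) (B : Fin M → Finset (Fin m)) : Prop where
  card_eq : ∀ j, (B j).card = b
  disjoint : ∀ i j, i ≠ j → Disjoint (B i) (B j)
  cover : ∀ i, ∃ j, i ∈ B j

/-- The submatrix of `A` formed by the rows with index in `S`. -/
def batchMatrix {m n : ℕ} (A : Matrix (Fin m) (Fin n) ℝ) (S : Finset (Fin m)) :
    Matrix S (Fin n) ℝ :=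
  A.submatrix Subtype.val id

end

/-! For a fixed vector `u`, the sum of `⟨a_i, u⟩²` over a batch has mean `b‖u‖²` and variance at
most `b C⁴ ‖u‖⁴`, so by Chebyshev a batch with `b ≥ 2⁸¹ C⁴` falls below a quarter of its mean with
probability at most `2⁻⁸⁰`. Batches are independent, so more than `M / 20` of them fail with
probability at most `e^(-2M)` (`measureReal_many_blocks_le`): counting batches turns weak moments
into exponential concentration.

Uniformity over a subspace (`exists_bad_event_subspace`) comes from a grid. Passing from grid points
to all unit vectors needs an upper bound on the batches; Markov for the Frobenius norm gives one for
most batches, and a mesh of order `1 / n` absorbs its losses.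

A ReLU network agrees at each point with one of at most `(n + 1)^(k d)` affine maps
(`IsReLUNetwork.exists_affine_cover`), by a VC count of sign patterns in each layer. Hence all
differences `G z₁ - G z₂` lie in at most `(n + 1)^(2 k d)` subspaces of dimension at most `2 k + 1`.
The union bound runs over at most `n^(143 k d) ≤ e^M` events, which `e^(-2M)` beats. -/

/-! ### Tail bounds for independent blocks -/

/-- Events that depend on disjoint blocks of independent random variables: if each of them has
probability at most `p`, then those indexed by `T` occur together with probability at most
`p ^ #T`. -/
lemma measureReal_biInter_block_le {Ω E ι κ : Type*} [MeasurableSpace Ω] {μ : Measure Ω}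
    [IsProbabilityMeasure μ] [MeasurableSpace E] {a : ι → Ω → E} (hind : iIndepFun a μ)
    (ha : ∀ i, Measurable (a i)) {B : κ → Finset ι} (hB : ∀ i j, i ≠ j → Disjoint (B i) (B j))
    {g : E → ℝ} (hg : Measurable g) {S : Set ℝ} (hS : MeasurableSet S) {p : ℝ} (hp : 0 ≤ p)
    (h : ∀ j, μ.real {ω | ∑ i ∈ B j, g (a i ω) ∈ S} ≤ p) (T : Finset κ) :
    μ.real (⋂ j ∈ T, {ω | ∑ i ∈ B j, g (a i ω) ∈ S}) ≤ p ^ T.card := by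
  classical
  induction T using Finset.induction_on with
  | empty => simp
  | insert j T hj ih =>
    have hd : Disjoint (B j) (T.biUnion B) := by
      rw [Finset.disjoint_biUnion_right]
      intro t ht
      exact hB _ _ (by rintro rfl; exact hj ht)
    have hI := hind.indepFun_finset (B j) (T.biUnion B) hd ha
    let S₁ : Set (B j → E) := {x | ∑ i, g (x i) ∈ S}
    -- Extending each block sum by zero to the whole union makes the events of `T` a single event
    -- about the variables outside `B j`.
    let S₂ : Set (T.biUnion B → E) :=
      ⋂ t ∈ T, {x | ∑ i : T.biUnion B, (if i.1 ∈ B t then g (x i) else 0) ∈ S}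
    have hS₁ : MeasurableSet S₁ :=
      (Finset.measurable_sum _ fun i _ => hg.comp (measurable_pi_apply i)) hS
    have hS₂ : MeasurableSet S₂ := by
      refine Finset.measurableSet_biInter _ fun t _ => ?_
      refine (Finset.measurable_sum _ fun i _ => ?_) hS
      split_ifs
      · exact hg.comp (measurable_pi_apply i)
      · exact measurable_const
    have e₁ : {ω | ∑ i ∈ B j, g (a i ω) ∈ S} = (fun ω (i : B j) => a i ω) ⁻¹' S₁ := by
      ext ω
      simp only [S₁, Set.mem_ofPred_eq, Set.mem_preimage]
      rw [← Finset.sum_coe_sort (B j) fun i => g (a i ω)]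
    have e₂ : (⋂ t ∈ T, {ω | ∑ i ∈ B t, g (a i ω) ∈ S}) =
        (fun ω (i : T.biUnion B) => a i ω) ⁻¹' S₂ := by
      ext ω
      simp only [S₂, Set.mem_iInter, Set.mem_ofPred_eq, Set.mem_preimage]
      refine forall₂_congr fun t ht => ?_
      have : ∑ i : T.biUnion B, (if i.1 ∈ B t then g (a i ω) else 0) =
          ∑ i ∈ B t, g (a i ω) := by
        rw [Finset.sum_coe_sort (T.biUnion B) fun i => if i ∈ B t then g (a i ω) else 0,
          ← Finset.sum_filter, Finset.filter_mem_eq_inter,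
          Finset.inter_eq_right.2 (Finset.subset_biUnion_of_mem B ht)]
      rw [this]
    rw [Finset.set_biInter_insert, Finset.card_insert_of_notMem hj, pow_succ', e₁, e₂,
      measureReal_def, hI.measure_inter_preimage_eq_mul _ _ hS₁ hS₂, ENNReal.toReal_mul,
      ← measureReal_def, ← measureReal_def, ← e₁, ← e₂]
    exact mul_le_mul (h j) ih measureReal_nonneg hp

/-- Among `M` events depending on disjoint blocks of independent variables, each of probability at
most `2⁻⁸⁰`, more than `M / 20` occur with probability at most `exp (-2 M)`. -/
lemma measureReal_many_blocks_le {Ω E ι : Type*} [MeasurableSpace Ω] {μ : Measure Ω}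
    [IsProbabilityMeasure μ] [MeasurableSpace E] {a : ι → Ω → E} (hind : iIndepFun a μ)
    (ha : ∀ i, Measurable (a i)) {M : ℕ} {B : Fin M → Finset ι}
    (hB : ∀ i j, i ≠ j → Disjoint (B i) (B j))
    {g : E → ℝ} (hg : Measurable g) {S : Set ℝ} (hS : MeasurableSet S)
    (h : ∀ j, μ.real {ω | ∑ i ∈ B j, g (a i ω) ∈ S} ≤ (2⁻¹ : ℝ) ^ 80) :
    μ.real {ω | ∃ T : Finset (Fin M), (M : ℝ) / 20 < T.card ∧
      ∀ j ∈ T, ∑ i ∈ B j, g (a i ω) ∈ S} ≤ Real.exp (-(2 * M)) := by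
  classical
  let F : Finset (Finset (Fin M)) := Finset.univ.filter fun T => (M : ℝ) / 20 < T.card
  have hsub : {ω | ∃ T : Finset (Fin M), (M : ℝ) / 20 < T.card ∧
      ∀ j ∈ T, ∑ i ∈ B j, g (a i ω) ∈ S} ⊆
      ⋃ T ∈ F, ⋂ j ∈ T, {ω | ∑ i ∈ B j, g (a i ω) ∈ S} := by
    rintro ω ⟨T, hT, hω⟩
    simp only [Set.mem_iUnion, Set.mem_iInter]
    exact ⟨T, by simpa [F] using hT, hω⟩
  -- `80 · M / 20 = 4 M`; the `2^M` choices of `T` then leave `8^(-M) ≤ e^(-2M)`.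
  have hT : ∀ T ∈ F, μ.real (⋂ j ∈ T, {ω | ∑ i ∈ B j, g (a i ω) ∈ S}) ≤ (2⁻¹ : ℝ) ^ (4 * M) := by
    intro T hT
    refine (measureReal_biInter_block_le hind ha hB hg hS (by positivity) h T).trans ?_
    rw [← pow_mul]
    refine pow_le_pow_of_le_one (by norm_num) (by norm_num) ?_
    have : (M : ℝ) / 20 < T.card := by simpa [F] using hT
    have : (M : ℝ) < 20 * T.card := by linarith
    have : M < 20 * T.card := by exact_mod_cast this
    omega
  have hcard : (F.card : ℝ) ≤ 2 ^ M := by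
    have : F.card ≤ 2 ^ M := (Finset.card_filter_le _ _).trans (by simp)
    exact_mod_cast this
  calc _ ≤ μ.real (⋃ T ∈ F, ⋂ j ∈ T, {ω | ∑ i ∈ B j, g (a i ω) ∈ S}) :=
        measureReal_mono hsub (measure_ne_top _ _)
    _ ≤ ∑ T ∈ F, μ.real (⋂ j ∈ T, {ω | ∑ i ∈ B j, g (a i ω) ∈ S}) :=
        measureReal_biUnion_finset_le _ _
    _ ≤ F.card • (2⁻¹ : ℝ) ^ (4 * M) := Finset.sum_le_card_nsmul _ _ _ hT
    _ ≤ 2 ^ M * (2⁻¹ : ℝ) ^ (4 * M) := by rw [nsmul_eq_mul]; gcongr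
    _ = ((2⁻¹ : ℝ) ^ 3) ^ M := by rw [pow_mul, ← mul_pow]; norm_num
    _ ≤ Real.exp (-2) ^ M := by
        gcongr
        rw [Real.exp_neg, inv_pow]
        gcongr
        have := Real.exp_one_lt_d9
        calc Real.exp 2 = Real.exp 1 ^ 2 := by rw [← Real.exp_nat_mul]; norm_num
          _ ≤ 2.7182818286 ^ 2 := by gcongr
          _ ≤ 2 ^ 3 := by norm_num
    _ = Real.exp (-(2 * M)) := by rw [← Real.exp_nat_mul]; ring_nf

/-- The squared norm of `A_S u` is the sum of the squared inner products with the rows in `S`. -/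
lemma norm_sq_batchMatrix {m n : ℕ} (A : Matrix (Fin m) (Fin n) ℝ) (S : Finset (Fin m))
    (u : Vec n) :
    ‖Matrix.toEuclideanLin (batchMatrix A S) u‖ ^ 2 = ∑ i ∈ S, inner ℝ (rowVec A i) u ^ 2 := by
  rw [EuclideanSpace.real_norm_sq_eq, ← Finset.sum_coe_sort S]
  refine Finset.sum_congr rfl fun i _ => ?_
  congr 1
  simp [batchMatrix, rowVec, PiLp.inner_apply, Matrix.toLpLin_apply, Matrix.mulVec, dotProduct,
    mul_comm]

/-! ### Moment inequalities for one batch -/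

section Batch

variable {Ω : Type*} [MeasurableSpace Ω] {μ : Measure Ω} {m n : ℕ}
  {A : Ω → Matrix (Fin m) (Fin n) ℝ} {C : ℝ}

lemma IsHeavyTailed.integral_pow_four_le {a : Ω → Vec n} (h : IsHeavyTailed μ a C)
    (hi : IsIsotropic μ a) (u : Vec n) :
    ∫ ω, inner ℝ (a ω) u ^ 4 ∂μ ≤ C ^ 4 * ‖u‖ ^ 4 := by
  have h1 := (h u).2
  rw [(hi u).2, ← Real.sqrt_eq_rpow, Real.sqrt_sq (norm_nonneg u)] at h1
  have h0 : 0 ≤ ∫ ω, inner ℝ (a ω) u ^ 4 ∂μ := integral_nonneg fun ω => by positivity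
  have := pow_le_pow_left₀ (Real.rpow_nonneg h0 _) h1 4
  rw [← Real.rpow_natCast, ← Real.rpow_mul h0] at this
  norm_num at this
  rwa [mul_pow] at this

variable [IsProbabilityMeasure μ]

/-- Chebyshev's inequality for the average of `⟨a_i, u⟩²` over a batch. -/
lemma measureReal_batch_lt_le (hA : IsHeavyTailedMatrix μ A C) (hC : 0 < C)
    {S : Finset (Fin m)} (hS : 2 ^ 81 * C ^ 4 ≤ (S.card : ℝ)) (u : Vec n) :
    μ.real {ω | ∑ i ∈ S, inner ℝ (rowVec (A ω) i) u ^ 2 < S.card * ‖u‖ ^ 2 / 4} ≤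
      (2⁻¹ : ℝ) ^ 80 := by
  have hb : (0 : ℝ) < S.card := lt_of_lt_of_le (by positivity) hS
  rcases eq_or_ne u 0 with rfl | hu
  · simp
  have hu : 0 < ‖u‖ := norm_pos_iff.2 hu
  let X : Fin m → Ω → ℝ := fun i ω => inner ℝ (rowVec (A ω) i) u ^ 2
  have hm : Measurable fun v : Vec n => inner ℝ v u ^ 2 := by fun_prop
  have hXm : ∀ i, Measurable (X i) := fun i => hm.comp (hA.measurable_row i)
  have hX : ∀ i, MemLp (X i) 2 μ := by
    intro i
    have h4 := ((hA.heavyTailed i) u).1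
    rw [memLp_two_iff_integrable_sq (hXm i).aestronglyMeasurable]
    have := h4.integrable_norm_pow (by norm_num)
    refine this.congr (Filter.Eventually.of_forall fun ω => ?_)
    simp only [X, Real.norm_eq_abs]
    rw [← pow_mul]
    exact Even.pow_abs (by decide) _
  have hind : iIndepFun X μ := hA.indep.comp _ fun _ => hm
  have hvar : Var[∑ i ∈ S, X i; μ] ≤ S.card * (C ^ 4 * ‖u‖ ^ 4) := by
    rw [IndepFun.variance_sum (fun i _ => hX i) fun i _ j _ hij => hind.indepFun hij,
      ← nsmul_eq_mul]
    refine Finset.sum_le_card_nsmul _ _ _ fun i _ => ?_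
    refine (variance_le_expectation_sq (hXm i).aestronglyMeasurable).trans ?_
    refine le_trans (le_of_eq ?_) ((hA.heavyTailed i).integral_pow_four_le (hA.isotropic i) u)
    refine integral_congr_ae (Filter.Eventually.of_forall fun ω => ?_)
    simp only [X, Pi.pow_apply]
    ring
  have hmean : ∫ ω, (∑ i ∈ S, X i) ω ∂μ = S.card * ‖u‖ ^ 2 := by
    simp only [Finset.sum_apply]
    rw [integral_finsetSum _ fun i _ => (hX i).integrable one_le_two]
    simp only [X, ((hA.isotropic _) u).2]
    simp
  -- A sum below a quarter of its mean deviates by at least three quarters of it. The resulting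
  -- factor `16 / 9 ≤ 2` is why the batch size is compared with `2⁸¹` rather than `2⁸⁰`.
  have hch := meas_ge_le_variance_div_sq (memLp_finsetSum' S fun i _ => hX i)
    (c := S.card * ‖u‖ ^ 2 * (3 / 4)) (by positivity)
  rw [hmean] at hch
  have hch' := ENNReal.toReal_le_of_le_ofReal (by positivity [variance_nonneg (∑ i ∈ S, X i) μ]) hch
  calc _ ≤ μ.real {ω | S.card * ‖u‖ ^ 2 * (3 / 4) ≤
          |(∑ i ∈ S, X i) ω - S.card * ‖u‖ ^ 2|} := by
        refine measureReal_mono fun ω hω => ?_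
        simp only [Set.mem_ofPred_eq, Finset.sum_apply, X] at hω ⊢
        rw [abs_sub_comm]
        refine le_trans ?_ (le_abs_self _)
        linarith
    _ ≤ _ := hch'
    _ ≤ S.card * (C ^ 4 * ‖u‖ ^ 4) / (S.card * ‖u‖ ^ 2 * (3 / 4)) ^ 2 := by gcongr
    _ = (16 / 9) * C ^ 4 / S.card := by field_simp; norm_num
    _ ≤ (2⁻¹ : ℝ) ^ 80 := by
        rw [div_le_iff₀ hb]
        have : (0 : ℝ) < C ^ 4 := by positivity
        norm_num at hS ⊢
        linarith

/-- Markov's inequality for the squared Frobenius norm of a batch restricted to a subspace. -/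
lemma measureReal_frobenius_gt_le (hA : IsHeavyTailedMatrix μ A C) (S : Finset (Fin m)) {D : ℕ}
    (e : Fin D → Vec n) (he : ∀ l, ‖e l‖ = 1) :
    μ.real {ω | S.card * D * 2 ^ 80 < ∑ i ∈ S, ∑ l, inner ℝ (rowVec (A ω) i) (e l) ^ 2} ≤
      (2⁻¹ : ℝ) ^ 80 := by
  have hint : ∀ i l, Integrable (fun ω => inner ℝ (rowVec (A ω) i) (e l) ^ 2) μ :=
    fun i l => ((hA.isotropic i) (e l)).1.integrable_sq
  have hmean : ∫ ω, ∑ i ∈ S, ∑ l, inner ℝ (rowVec (A ω) i) (e l) ^ 2 ∂μ = S.card * D := by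
    rw [integral_finsetSum _ fun i _ => integrable_finsetSum _ fun l _ => hint i l]
    simp_rw [integral_finsetSum _ fun l _ => hint _ l, ((hA.isotropic _) _).2, he]
    simp
  have hM := mul_meas_ge_le_integral_of_nonneg (μ := μ)
    (f := fun ω => ∑ i ∈ S, ∑ l, inner ℝ (rowVec (A ω) i) (e l) ^ 2)
    (Filter.Eventually.of_forall fun ω => by simp only [Pi.zero_apply]; positivity)
    (integrable_finsetSum _ fun i _ => integrable_finsetSum _ fun l _ => hint i l)
    (S.card * D * 2 ^ 80)
  rw [hmean] at hM
  rcases eq_or_lt_of_le (show (0 : ℝ) ≤ S.card * D by positivity) with h0 | h0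
  · have : S = ∅ ∨ D = 0 := by
      have := h0.symm
      simpa using this
    rcases this with rfl | rfl <;> simp
  · have hmono : μ.real
        {ω | S.card * D * 2 ^ 80 < ∑ i ∈ S, ∑ l, inner ℝ (rowVec (A ω) i) (e l) ^ 2} ≤
        μ.real {ω | S.card * D * 2 ^ 80 ≤ ∑ i ∈ S, ∑ l, inner ℝ (rowVec (A ω) i) (e l) ^ 2} :=
      measureReal_mono fun ω hω => by
        simp only [Set.mem_ofPred_eq] at hω ⊢
        exact hω.le
    refine hmono.trans ?_
    rw [mul_assoc, ← le_div_iff₀' h0, div_self h0.ne'] at hM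
    rw [inv_pow, ← one_div, le_div_iff₀' (by positivity)]
    exact hM

end Batch

/-! ### Uniformity over a subspace -/

section Subspace

variable {Ω : Type*} [MeasurableSpace Ω] {μ : Measure Ω} [IsProbabilityMeasure μ] {m n M b : ℕ}
  {A : Ω → Matrix (Fin m) (Fin n) ℝ} {C : ℝ} {B : Fin M → Finset (Fin m)}

/-- For a fixed vector, more than `M / 20` batches have a small average only with exponentially
small probability. -/
lemma measureReal_many_small_batches_le (hA : IsHeavyTailedMatrix μ A C) (hC : 0 < C)
    (hB : IsBatching b B) (hb : 2 ^ 81 * C ^ 4 ≤ (b : ℝ)) (u : Vec n) :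
    μ.real {ω | ∃ T : Finset (Fin M), (M : ℝ) / 20 < T.card ∧
      ∀ j ∈ T, ∑ i ∈ B j, inner ℝ (rowVec (A ω) i) u ^ 2 ∈ Set.Iio (b * ‖u‖ ^ 2 / 4)} ≤
      Real.exp (-(2 * M)) := by
  refine measureReal_many_blocks_le hA.indep hA.measurable_row hB.disjoint
    (g := fun v => inner ℝ v u ^ 2) (by fun_prop) measurableSet_Iio fun j => ?_
  have := measureReal_batch_lt_le hA hC (S := B j) (by rwa [hB.card_eq]) u
  rwa [hB.card_eq] at this

/-- For fixed unit vectors, more than `M / 20` batches have a large Frobenius norm on them only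
with exponentially small probability. -/
lemma measureReal_many_large_batches_le (hA : IsHeavyTailedMatrix μ A C)
    (hB : IsBatching b B) {D : ℕ} (e : Fin D → Vec n) (he : ∀ l, ‖e l‖ = 1) :
    μ.real {ω | ∃ T : Finset (Fin M), (M : ℝ) / 20 < T.card ∧
      ∀ j ∈ T, ∑ i ∈ B j, ∑ l, inner ℝ (rowVec (A ω) i) (e l) ^ 2 ∈
        Set.Ioi (b * D * 2 ^ 80 : ℝ)} ≤ Real.exp (-(2 * M)) := by
  refine measureReal_many_blocks_le hA.indep hA.measurable_row hB.disjoint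
    (g := fun v => ∑ l, inner ℝ v (e l) ^ 2) (by fun_prop) measurableSet_Ioi fun j => ?_
  have := measureReal_frobenius_gt_le hA (B j) e he
  rwa [hB.card_eq] at this

/-- If `v` is close to the unit vector `u` and the batch `S` is good for `v` and not too large on
the unit vectors `e`, then it is good for `u`. -/
lemma batch_lower_bound_of_near {ι : Type*} (a : ι → Vec n) (S : Finset ι)
    {D : ℕ} (e : Fin D → Vec n) (he : ∀ l, ‖e l‖ = 1) (hD : D ≤ n) {u v : Vec n} (hu : ‖u‖ = 1)
    (y : Fin D → ℝ) (hy : ∀ l, |y l| ≤ 1 / (8 * n * 2 ^ 40)) (huv : u = v + ∑ l, y l • e l)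
    {b : ℝ} (hb : 0 ≤ b) (hv : b * ‖v‖ ^ 2 / 4 ≤ ∑ i ∈ S, inner ℝ (a i) v ^ 2)
    (hF : ∑ i ∈ S, ∑ l, inner ℝ (a i) (e l) ^ 2 ≤ b * D * 2 ^ 80) :
    b / 64 ≤ ∑ i ∈ S, inner ℝ (a i) u ^ 2 := by
  rcases Nat.eq_zero_or_pos n with rfl | hn
  · rw [Subsingleton.elim u 0] at hu
    simp at hu
  have hn' : (0 : ℝ) < n := by exact_mod_cast hn
  have hDn : (D : ℝ) ≤ n := by exact_mod_cast hD
  set w := ∑ l, y l • e l with hw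
  have hwnorm : ‖w‖ ≤ 1 / 8 := by
    calc ‖w‖ ≤ ∑ l, ‖y l • e l‖ := norm_sum_le _ _
      _ ≤ (Finset.univ : Finset (Fin D)).card • (1 / (8 * n * 2 ^ 40) : ℝ) := by
        refine Finset.sum_le_card_nsmul _ _ _ fun l _ => ?_
        rw [norm_smul, he, mul_one]
        exact hy l
      _ = D / (8 * n * 2 ^ 40) := by simp [div_eq_mul_inv]
      _ ≤ n / (8 * n * 2 ^ 40) := by gcongr
      _ ≤ 1 / 8 := by
        rw [div_le_div_iff₀ (by positivity) (by norm_num)]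
        linarith
  have hvnorm : 7 / 8 ≤ ‖v‖ := by
    have := norm_add_le v w
    rw [← huv, hu] at this
    linarith
  have hy2 : ∑ l, y l ^ 2 ≤ D * (1 / (8 * n * 2 ^ 40)) ^ 2 := by
    have : ∑ l, y l ^ 2 ≤ (Finset.univ : Finset (Fin D)).card • (1 / (8 * n * 2 ^ 40) : ℝ) ^ 2 := by
      refine Finset.sum_le_card_nsmul _ _ _ fun l _ => ?_
      rw [← sq_abs]
      exact pow_le_pow_left₀ (abs_nonneg _) (hy l) 2
    simpa using this
  -- Cauchy–Schwarz in the coordinates of `w`; the `2 ^ 40` in the mesh is the square root of the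
  -- Frobenius factor `2 ^ 80`.
  have hAw : ∑ i ∈ S, inner ℝ (a i) w ^ 2 ≤ b / 64 := by
    calc ∑ i ∈ S, inner ℝ (a i) w ^ 2
        ≤ ∑ i ∈ S, (∑ l, y l ^ 2) * ∑ l, inner ℝ (a i) (e l) ^ 2 := by
          refine Finset.sum_le_sum fun i _ => ?_
          rw [hw, inner_sum]
          simp only [inner_smul_right]
          exact Finset.sum_mul_sq_le_sq_mul_sq _ _ _
      _ = (∑ l, y l ^ 2) * ∑ i ∈ S, ∑ l, inner ℝ (a i) (e l) ^ 2 := by rw [Finset.mul_sum]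
      _ ≤ (D * (1 / (8 * n * 2 ^ 40)) ^ 2) * (b * D * 2 ^ 80) := by gcongr
      _ ≤ (n * (1 / (8 * n * 2 ^ 40)) ^ 2) * (b * n * 2 ^ 80) := by gcongr
      _ = b / 64 := by field_simp; ring
  -- This is `(s + t)² ≥ s² / 2 - t²`. The final count is `(1/2)(1/4)(49/64) - 1/64 = 41/512 ≥
  -- 1/64`.
  have hsplit : (1 / 2) * ∑ i ∈ S, inner ℝ (a i) v ^ 2 - ∑ i ∈ S, inner ℝ (a i) w ^ 2 ≤
      ∑ i ∈ S, inner ℝ (a i) u ^ 2 := by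
    rw [Finset.mul_sum, ← Finset.sum_sub_distrib]
    refine Finset.sum_le_sum fun i _ => ?_
    rw [huv, inner_add_right]
    linarith [sq_nonneg (inner ℝ (a i) v + 2 * inner ℝ (a i) w)]
  have hv2 : (49 / 64 : ℝ) ≤ ‖v‖ ^ 2 := by
    calc (49 / 64 : ℝ) = (7 / 8) ^ 2 := by norm_num
      _ ≤ ‖v‖ ^ 2 := by gcongr
  have hbv : b * (49 / 64) ≤ b * ‖v‖ ^ 2 := by gcongr
  linarith

/-- If at most `M / 20` indices violate each of two conditions, then at least `0.9 M` indices
satisfy both. -/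
lemma exists_large_finset {P Q : Fin M → Prop}
    (hP : ¬ ∃ T : Finset (Fin M), (M : ℝ) / 20 < T.card ∧ ∀ j ∈ T, P j)
    (hQ : ¬ ∃ T : Finset (Fin M), (M : ℝ) / 20 < T.card ∧ ∀ j ∈ T, Q j) :
    ∃ J : Finset (Fin M), 0.9 * (M : ℝ) ≤ J.card ∧ ∀ j ∈ J, ¬ P j ∧ ¬ Q j := by
  classical
  have h1 : ((Finset.univ.filter P).card : ℝ) ≤ M / 20 := by
    by_contra! h
    exact hP ⟨_, h, fun j hj => (Finset.mem_filter.1 hj).2⟩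
  have h2 : ((Finset.univ.filter Q).card : ℝ) ≤ M / 20 := by
    by_contra! h
    exact hQ ⟨_, h, fun j hj => (Finset.mem_filter.1 hj).2⟩
  refine ⟨(Finset.univ.filter P ∪ Finset.univ.filter Q)ᶜ, ?_, fun j hj => by simpa using hj⟩
  have h3 := Finset.card_compl_add_card (Finset.univ.filter P ∪ Finset.univ.filter Q)
  rw [Fintype.card_fin] at h3
  have h4 := Finset.card_union_le (Finset.univ.filter P) (Finset.univ.filter Q)
  have h3' : (((Finset.univ.filter P ∪ Finset.univ.filter Q)ᶜ).card : ℝ) +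
    (Finset.univ.filter P ∪ Finset.univ.filter Q).card = M := by exact_mod_cast h3
  have h4' : ((Finset.univ.filter P ∪ Finset.univ.filter Q).card : ℝ) ≤
    (Finset.univ.filter P).card + (Finset.univ.filter Q).card := by exact_mod_cast h4
  linarith

/-- At least `0.9 M` batches satisfy the lower bound for the vector `u`. -/
def MostBatchesLarge (b : ℕ) (B : Fin M → Finset (Fin m)) (A : Matrix (Fin m) (Fin n) ℝ)
    (u : Vec n) : Prop :=
  ∃ J : Finset (Fin M), 0.9 * (M : ℝ) ≤ J.card ∧
    ∀ j ∈ J, (1 / 8 : ℝ) ^ 2 * ‖u‖ ^ 2 ≤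
      1 / (b : ℝ) * ‖Matrix.toEuclideanLin (batchMatrix A (B j)) u‖ ^ 2

/-- Homogeneity reduces a subspace to its unit vectors, and a line to one spanning vector. -/
lemma MostBatchesLarge.smul {A : Matrix (Fin m) (Fin n) ℝ} {u : Vec n}
    (h : MostBatchesLarge b B A u) (r : ℝ) : MostBatchesLarge b B A (r • u) := by
  obtain ⟨J, hJ, h⟩ := h
  refine ⟨J, hJ, fun j hj => ?_⟩
  have := mul_le_mul_of_nonneg_left (h j hj) (sq_nonneg ‖r‖)
  rw [map_smul, norm_smul, norm_smul, mul_pow, mul_pow]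
  linarith

lemma mostBatchesLarge_zero (A : Matrix (Fin m) (Fin n) ℝ) : MostBatchesLarge b B A 0 := by
  refine ⟨Finset.univ, ?_, fun j _ => by simp⟩
  have : (0 : ℝ) ≤ M := M.cast_nonneg
  simp
  linarith

/-- For a fixed unit vector most batches are large, outside an event of small probability. -/
lemma exists_bad_event_vector (hA : IsHeavyTailedMatrix μ A C) (hC : 0 < C)
    (hB : IsBatching b B) (hb : 2 ^ 81 * C ^ 4 ≤ (b : ℝ)) (u : Vec n) :
    ∃ N : Set Ω, μ.real N ≤ Real.exp (-(2 * M)) ∧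
      ∀ ω, ω ∉ N → MostBatchesLarge b B (A ω) u := by
  have hb0 : (0 : ℝ) < b := lt_of_lt_of_le (by positivity) hb
  refine ⟨_, measureReal_many_small_batches_le hA hC hB hb u, fun ω hω => ?_⟩
  -- Only one kind of failure occurs here, so it fills both slots.
  obtain ⟨J, hJ, h⟩ := exists_large_finset hω hω
  refine ⟨J, hJ, fun j hj => ?_⟩
  have h1 := (h j hj).1
  rw [Set.mem_Iio, not_lt] at h1
  rw [norm_sq_batchMatrix, one_div_mul_eq_div, le_div_iff₀ hb0]
  have : 0 ≤ b * ‖u‖ ^ 2 := by positivity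
  linarith

/-- Uniformly over a subspace most batches are large, outside an event of small probability. -/
lemma exists_bad_event_subspace (hA : IsHeavyTailedMatrix μ A C) (hC : 0 < C)
    (hB : IsBatching b B) (hb : 2 ^ 81 * C ^ 4 ≤ (b : ℝ)) (V : Submodule ℝ (Vec n)) :
    ∃ N : Set Ω, μ.real N ≤ ((16 * n * 2 ^ 40 + 1) ^ Module.finrank ℝ V + 1 : ℕ) *
        Real.exp (-(2 * M)) ∧
      ∀ ω, ω ∉ N → ∀ u ∈ V, MostBatchesLarge b B (A ω) u := by
  classical
  have hb0 : (0 : ℝ) < b := lt_of_lt_of_le (by positivity) hb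
  set D := Module.finrank ℝ V
  have hD : D ≤ n := by simpa using V.finrank_le
  let e := stdOrthonormalBasis ℝ V
  have he : ∀ l, ‖((e l : V) : Vec n)‖ = 1 := fun l => e.norm_eq_one l
  -- The inverse mesh. The grid fills the cube `[-1, 1]^D` in orthonormal coordinates, so its points
  -- need not be unit vectors.
  let q : ℕ := 8 * n * 2 ^ 40
  let Z : Finset (Fin D → ℤ) := Fintype.piFinset fun _ => Finset.Icc (-(q : ℤ)) q
  have hZ : Z.card = (16 * n * 2 ^ 40 + 1) ^ D := by
    simp only [Z, Fintype.card_piFinset, Int.card_Icc, Finset.prod_const, Finset.card_univ,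
      Fintype.card_fin]
    congr 1
    simp only [q]
    omega
  let p : (Fin D → ℤ) → Vec n := fun z => ∑ l, ((z l : ℝ) / q) • (e l : Vec n)
  let N₁ : Vec n → Set Ω := fun v => {ω | ∃ T : Finset (Fin M), (M : ℝ) / 20 < T.card ∧
      ∀ j ∈ T, ∑ i ∈ B j, inner ℝ (rowVec (A ω) i) v ^ 2 ∈ Set.Iio (b * ‖v‖ ^ 2 / 4)}
  let N₂ : Set Ω := {ω | ∃ T : Finset (Fin M), (M : ℝ) / 20 < T.card ∧
      ∀ j ∈ T, ∑ i ∈ B j, ∑ l, inner ℝ (rowVec (A ω) i) (e l : Vec n) ^ 2 ∈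
        Set.Ioi (b * D * 2 ^ 80 : ℝ)}
  refine ⟨(⋃ z ∈ Z, N₁ (p z)) ∪ N₂, ?_, fun ω hω => ?_⟩
  · calc _ ≤ μ.real (⋃ z ∈ Z, N₁ (p z)) + μ.real N₂ := measureReal_union_le _ _
      _ ≤ Z.card • Real.exp (-(2 * M)) + Real.exp (-(2 * M)) := by
        refine add_le_add ((measureReal_biUnion_finset_le _ _).trans
          (Finset.sum_le_card_nsmul _ _ _ fun z _ => ?_)) ?_
        · exact measureReal_many_small_batches_le hA hC hB hb (p z)
        · exact measureReal_many_large_batches_le hA hB _ he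
      _ = _ := by rw [hZ, nsmul_eq_mul]; push_cast; ring
  have hunit : ∀ u ∈ V, ‖u‖ = 1 → MostBatchesLarge b B (A ω) u := by
    intro u huV hu
    have hn : 0 < n := by
      rcases Nat.eq_zero_or_pos n with rfl | hn
      · rw [Subsingleton.elim u 0] at hu
        simp at hu
      · exact hn
    have hq : (0 : ℝ) < q := by
      have : 0 < q := by positivity
      exact_mod_cast this
    let x : Fin D → ℝ := fun l => e.repr ⟨u, huV⟩ l
    have hx : u = ∑ l, x l • (e l : Vec n) := by
      have := congrArg (Subtype.val) (e.sum_repr ⟨u, huV⟩)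
      simpa [x] using this.symm
    have hx1 : ∀ l, |x l| ≤ 1 := by
      intro l
      have := PiLp.norm_apply_le (e.repr ⟨u, huV⟩) l
      rw [e.repr.norm_map] at this
      exact this.trans (le_of_eq hu)
    let z : Fin D → ℤ := fun l => ⌊q * x l⌋
    have hzZ : z ∈ Z := by
      refine Fintype.mem_piFinset.2 fun l => Finset.mem_Icc.2 ⟨?_, ?_⟩
      · refine Int.le_floor.2 ?_
        push_cast
        have := (abs_le.1 (hx1 l)).1
        nlinarith
      · have h1 : ((⌊q * x l⌋ : ℤ) : ℝ) ≤ q := by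
          refine (Int.floor_le _).trans ?_
          have := (abs_le.1 (hx1 l)).2
          nlinarith
        exact_mod_cast h1
    simp only [Set.mem_union, Set.mem_iUnion, not_or, not_exists] at hω
    obtain ⟨J, hJ, h⟩ := exists_large_finset (hω.1 z hzZ) hω.2
    refine ⟨J, hJ, fun j hj => ?_⟩
    obtain ⟨h1, h2⟩ := h j hj
    rw [Set.mem_Iio, not_lt] at h1
    rw [Set.mem_Ioi, not_lt] at h2
    have := batch_lower_bound_of_near (fun i => rowVec (A ω) i) (B j) _ he hD hu
      (v := p z) (fun l => x l - z l / q) (fun l => ?_) ?_ hb0.le h1 h2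
    · rw [norm_sq_batchMatrix, one_div_mul_eq_div, le_div_iff₀ hb0, hu]
      linarith
    · have h3 := Int.floor_le (q * x l)
      have h4 := Int.lt_floor_add_one (q * x l)
      have h5 : x l - z l / q = (q * x l - ⌊q * x l⌋) / q := by
        simp only [z]
        field_simp
      have h6 : (8 * n * 2 ^ 40 : ℝ) = q := by simp only [q]; push_cast; ring
      rw [h5, h6, abs_div, abs_of_pos hq]
      gcongr
      rw [abs_of_nonneg (by linarith)]
      linarith
    · rw [← Finset.sum_add_distrib, hx]
      refine Finset.sum_congr rfl fun l _ => ?_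
      rw [← add_smul]
      congr 1
      ring
  intro u huV
  rcases eq_or_ne u 0 with rfl | hu
  · exact mostBatchesLarge_zero _
  have := (hunit (‖u‖⁻¹ • u) (V.smul_mem _ huV) (norm_smul_inv_norm hu)).smul ‖u‖
  rwa [smul_inv_smul₀ (norm_ne_zero_iff.2 hu)] at this

end Subspace

/-! ### Counting the affine pieces of a network -/

lemma sum_choose_le_pow (l k : ℕ) : ∑ i ∈ Finset.Iic k, l.choose i ≤ (l + 1) ^ k := by
  have h : Finset.Iic k = Finset.range (k + 1) := by ext; simp
  rw [h]
  clear h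
  induction k with
  | zero => simp
  | succ k ih =>
    rw [Finset.sum_range_succ]
    calc _ ≤ (l + 1) ^ k + l ^ (k + 1) := add_le_add ih (Nat.choose_le_pow _ _)
      _ ≤ (l + 1) ^ k + (l + 1) ^ k * l := by
        rw [pow_succ]
        gcongr
        omega
      _ = (l + 1) ^ (k + 1) := by ring

/-- The set of indices of the coordinates of `x` that are positive. -/
noncomputable def posPattern {l : ℕ} (x : Vec l) : Finset (Fin l) :=
  Finset.univ.filter fun i => 0 < x i

lemma mem_posPattern {l : ℕ} (x : Vec l) (i : Fin l) : i ∈ posPattern x ↔ 0 < x i := by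
  simp [posPattern]

/-- The sign patterns of `l` affine functionals on `ℝᵏ` shatter no set of more than `k` elements. -/
lemma card_le_of_shatters_posPattern {k l : ℕ} (φ : Vec k →ᵃ[ℝ] Vec l)
    {𝒜 : Finset (Finset (Fin l))} (h𝒜 : ∀ s ∈ 𝒜, ∃ z, posPattern (φ z) = s)
    {T : Finset (Fin l)} (hT : 𝒜.Shatters T) : T.card ≤ k := by
  classical
  by_contra! hk
  let v : T → Module.Dual ℝ (Vec k) := fun i =>
    (EuclideanSpace.proj (𝕜 := ℝ) (i : Fin l)).toLinearMap ∘ₗ φ.linear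
  have hv : ¬ LinearIndependent ℝ v := fun h => by
    have := h.fintype_card_le_finrank
    rw [Subspace.dual_finrank_eq, finrank_euclideanSpace_fin, Fintype.card_coe] at this
    omega
  obtain ⟨c, hc, i₀, hi₀⟩ := Fintype.not_linearIndependent_iff.1 hv
  -- More than `k` linear parts on `ℝᵏ` are dependent, so this combination of the functionals does
  -- not depend on `z`. Shattering will force it to have two incompatible signs.
  have hconst : ∀ z, ∑ i : T, c i * φ z i = ∑ i : T, c i * φ 0 i := by
    intro z
    have h1 := congrArg (fun f => f z) hc
    have h2 : φ z = φ.linear z + φ 0 := by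
      have := φ.map_vadd 0 z
      simpa using this
    simp only [v, LinearMap.sum_apply, LinearMap.smul_apply, LinearMap.comp_apply, smul_eq_mul,
      LinearMap.zero_apply, ContinuousLinearMap.coe_coe, PiLp.proj_apply] at h1
    rw [h2]
    simp only [PiLp.add_apply, mul_add, Finset.sum_add_distrib, h1, zero_add]
  -- evaluate at a point whose sign pattern is that of `s * c`
  have key : ∀ s : ℝ, (∃ i, 0 < s * c i) → 0 < s * ∑ i : T, c i * φ 0 i := by
    rintro s ⟨i₁, hi₁⟩
    obtain ⟨u, hu, hTu⟩ := hT (t := T.filter fun i => ∃ h : i ∈ T, 0 < s * c ⟨i, h⟩)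
      (Finset.filter_subset _ _)
    obtain ⟨z, rfl⟩ := h𝒜 u hu
    have hsign : ∀ i : T, 0 < φ z i ↔ 0 < s * c i := by
      intro i
      have := Finset.ext_iff.1 hTu i
      simpa [mem_posPattern] using this
    rw [← hconst z, Finset.mul_sum]
    refine Finset.sum_pos' (fun i _ => ?_) ⟨i₁, Finset.mem_univ _, ?_⟩
    · rw [← mul_assoc]
      by_cases h : 0 < s * c i
      · exact (mul_pos h ((hsign i).2 h)).le
      · exact mul_nonneg_of_nonpos_of_nonpos (not_lt.1 h) (not_lt.1 (mt (hsign i).1 h))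
    · rw [← mul_assoc]
      exact mul_pos hi₁ ((hsign i₁).2 hi₁)
  -- If no `s * c i` is positive, the empty pattern makes every `φ z i` nonpositive. Coordinates may
  -- vanish there, so only a weak inequality results; it suffices, since `key` is strict for the
  -- opposite sign.
  have hweak : ∀ s : ℝ, 0 ≤ s * ∑ i : T, c i * φ 0 i := by
    intro s
    by_cases h : ∃ i, 0 < s * c i
    · exact (key s h).le
    push Not at h
    obtain ⟨u, hu, hTu⟩ := hT (t := ∅) (Finset.empty_subset _)
    obtain ⟨z, rfl⟩ := h𝒜 u hu
    rw [← hconst z, Finset.mul_sum]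
    refine Finset.sum_nonneg fun i _ => ?_
    rw [← mul_assoc]
    refine mul_nonneg_of_nonpos_of_nonpos (h i) (not_lt.1 fun hpos => ?_)
    have : (i : Fin l) ∈ T ∩ posPattern (φ z) :=
      Finset.mem_inter.2 ⟨i.2, (mem_posPattern _ _).2 hpos⟩
    rw [hTu] at this
    simp at this
  rcases lt_or_gt_of_ne hi₀ with h | h
  · have h1 := key (-1) ⟨i₀, by linarith⟩
    have h2 := hweak 1
    linarith
  · have h1 := key 1 ⟨i₀, by linarith⟩
    have h2 := hweak (-1)
    linarith

/-- `l` affine functionals on `ℝᵏ` have at most `(l + 1)ᵏ` sign patterns. -/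
lemma exists_posPattern_cover {k l : ℕ} (φ : Vec k →ᵃ[ℝ] Vec l) :
    ∃ 𝒜 : Finset (Finset (Fin l)), 𝒜.card ≤ (l + 1) ^ k ∧ ∀ z, posPattern (φ z) ∈ 𝒜 := by
  classical
  let 𝒜 : Finset (Finset (Fin l)) := Finset.univ.filter fun s => ∃ z, posPattern (φ z) = s
  refine ⟨𝒜, ?_, fun z => by simp [𝒜]⟩
  have hdim : 𝒜.vcDim ≤ k := Finset.sup_le fun T hT =>
    card_le_of_shatters_posPattern φ (fun s hs => by simpa [𝒜] using hs)
      (Finset.mem_shatterer.1 hT)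
  -- Sauer–Shelah.
  calc 𝒜.card ≤ 𝒜.shatterer.card := Finset.card_le_card_shatterer _
    _ ≤ ∑ i ∈ Finset.Iic 𝒜.vcDim, l.choose i := by
      simpa using Finset.card_shatterer_le_sum_vcDim (𝒜 := 𝒜)
    _ ≤ ∑ i ∈ Finset.Iic k, l.choose i :=
      Finset.sum_le_sum_of_subset (Finset.Iic_subset_Iic.2 hdim)
    _ ≤ (l + 1) ^ k := sum_choose_le_pow l k

/-- The coordinate projection of `ℝˡ` that keeps the coordinates in `s`. -/
noncomputable def coordMask {l : ℕ} (s : Finset (Fin l)) : Vec l →ₗ[ℝ] Vec l :=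
  Matrix.toEuclideanLin (Matrix.diagonal fun i => if i ∈ s then (1 : ℝ) else 0)

lemma relu_eq_coordMask {l : ℕ} (x : Vec l) : relu x = coordMask (posPattern x) x := by
  ext i
  simp only [relu, coordMask, Matrix.toLpLin_apply, Matrix.mulVec_diagonal, mem_posPattern]
  split_ifs with h
  · simp [h.le]
  · simp [not_lt.1 h]

/-- The affine map `x ↦ W x + β`, bundled. -/
noncomputable def affineLayerMap {k n : ℕ} (W : Matrix (Fin n) (Fin k) ℝ) (β : Vec n) : Vec k →ᵃ[ℝ] Vec n :=
  (Matrix.toEuclideanLin W).toAffineMap + AffineMap.const ℝ (Vec k) β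

/-- On a fixed sign pattern the rectifier is a coordinate projection, so each pattern contributes
one affine map. -/
lemma exists_relu_affine_cover {k l : ℕ} (φ : Vec k →ᵃ[ℝ] Vec l) :
    ∃ Φ : Finset (Vec k →ᵃ[ℝ] Vec l), Φ.card ≤ (l + 1) ^ k ∧
      ∀ z, ∃ ψ ∈ Φ, relu (φ z) = ψ z := by
  classical
  obtain ⟨𝒜, h𝒜, hmem⟩ := exists_posPattern_cover φ
  refine ⟨𝒜.image fun s => (coordMask s).toAffineMap.comp φ, Finset.card_image_le.trans h𝒜,
    fun z => ⟨_, Finset.mem_image_of_mem _ (hmem z), ?_⟩⟩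
  exact relu_eq_coordMask _

/-- Along an affine map from `ℝᵏ`, a network of depth `d` and width at most `w` agrees at every
point with one of at most `(w + 1)^(k d)` affine maps. -/
lemma IsReLUNetwork.exists_affine_cover {w d l n : ℕ} {F : Vec l → Vec n}
    (hF : IsReLUNetwork w d l n F) (hn : n ≤ w) {k : ℕ} (φ : Vec k →ᵃ[ℝ] Vec l) :
    ∃ Φ : Finset (Vec k →ᵃ[ℝ] Vec n), Φ.card ≤ (w + 1) ^ (k * d) ∧
      ∀ z, ∃ ψ ∈ Φ, F (φ z) = ψ z := by
  classical
  induction hF with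
  | @reluOutput l n W β =>
    obtain ⟨Φ, hΦ, h⟩ := exists_relu_affine_cover ((affineLayerMap W β).comp φ)
    refine ⟨Φ, hΦ.trans ?_, h⟩
    rw [mul_one]
    gcongr
  | @affineOutput l n W β =>
    exact ⟨{(affineLayerMap W β).comp φ}, by simpa using Nat.one_le_pow _ _ (by omega),
      fun z => ⟨_, Finset.mem_singleton_self _, rfl⟩⟩
  | @hidden d l l' n hl W β F hF ih =>
    obtain ⟨Φ, hΦ, h⟩ := exists_relu_affine_cover ((affineLayerMap W β).comp φ)
    -- Each piece `ψ` is again an affine map on `ℝᵏ`, so the exponent gained per layer is the input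
    -- dimension `k`, not the width of the layer.
    choose Ψ hΨ hΨ' using fun ψ : Vec k →ᵃ[ℝ] Vec l' => ih hn ψ
    refine ⟨Φ.biUnion Ψ, ?_, fun z => ?_⟩
    · calc (Φ.biUnion Ψ).card ≤ Φ.card * (w + 1) ^ (k * d) :=
            Finset.card_biUnion_le_card_mul _ _ _ fun ψ _ => hΨ ψ
        _ ≤ (w + 1) ^ k * (w + 1) ^ (k * d) := by
            gcongr
            exact hΦ.trans (by gcongr)
        _ = (w + 1) ^ (k * (d + 1)) := by ring
    · obtain ⟨ψ, hψ, e⟩ := h z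
      obtain ⟨χ, hχ, e'⟩ := hΨ' ψ z
      refine ⟨χ, Finset.mem_biUnion.2 ⟨ψ, hψ, hχ⟩, ?_⟩
      rw [← e', ← e]
      rfl

/-! ### Subspaces of differences and the size of the union bound -/

/-- The span of all differences of values of two affine maps. -/
def differenceSpan {k n : ℕ} (φ ψ : Vec k →ᵃ[ℝ] Vec n) : Submodule ℝ (Vec n) :=
  (LinearMap.range φ.linear ⊔ LinearMap.range ψ.linear) ⊔ Submodule.span ℝ {φ 0 - ψ 0}

/-- The two points may lie on different pieces, so the constant terms need not cancel; their
difference costs the one extra dimension in `2 * k + 1`. -/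
lemma sub_mem_differenceSpan {k n : ℕ} (φ ψ : Vec k →ᵃ[ℝ] Vec n) (z₁ z₂ : Vec k) :
    φ z₁ - ψ z₂ ∈ differenceSpan φ ψ := by
  have h : ∀ (χ : Vec k →ᵃ[ℝ] Vec n) z, χ z = χ.linear z + χ 0 := fun χ z => by
    simpa using χ.map_vadd 0 z
  have : φ z₁ - ψ z₂ = (φ.linear z₁ + -ψ.linear z₂) + (φ 0 - ψ 0) := by
    rw [h φ z₁, h ψ z₂]
    abel
  rw [this]
  refine Submodule.add_mem_sup (Submodule.add_mem_sup ⟨z₁, rfl⟩ (neg_mem ⟨z₂, rfl⟩)) ?_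
  exact Submodule.mem_span_singleton_self _

lemma finrank_differenceSpan_le {k n : ℕ} (φ ψ : Vec k →ᵃ[ℝ] Vec n) :
    Module.finrank ℝ (differenceSpan φ ψ) ≤ 2 * k + 1 := by
  have hr : ∀ χ : Vec k →ₗ[ℝ] Vec n, Module.finrank ℝ (LinearMap.range χ) ≤ k := fun χ => by
    simpa using χ.finrank_range_le
  have h1 := Submodule.finrank_add_le_finrank_add_finrank
    (LinearMap.range φ.linear ⊔ LinearMap.range ψ.linear) (Submodule.span ℝ {φ 0 - ψ 0})
  have h2 := Submodule.finrank_add_le_finrank_add_finrank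
    (LinearMap.range φ.linear) (LinearMap.range ψ.linear)
  have h3 : Module.finrank ℝ (Submodule.span ℝ {φ 0 - ψ 0}) ≤ 1 := by
    simpa using finrank_span_le_card (R := ℝ) ({φ 0 - ψ 0} : Set (Vec n))
  have h4 := hr φ.linear
  have h5 := hr ψ.linear
  unfold differenceSpan
  omega

lemma IsReLUNetwork.one_le_depth {w d k n : ℕ} {G : Vec k → Vec n} (h : IsReLUNetwork w d k n G) :
    1 ≤ d := by
  cases h <;> omega

lemma IsBatching.card_le {m M b : ℕ} {B : Fin M → Finset (Fin m)} (hB : IsBatching b B) :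
    m ≤ M * b := by
  classical
  have h : (Finset.univ : Finset (Fin m)) ⊆ Finset.univ.biUnion B := fun i _ => by
    obtain ⟨j, hj⟩ := hB.cover i
    exact Finset.mem_biUnion.2 ⟨j, Finset.mem_univ _, hj⟩
  have h1 := (Finset.card_le_card h).trans
    (Finset.card_biUnion_le_card_mul _ _ b fun j _ => (hB.card_eq j).le)
  simpa using h1

/-- The number of pairs of linear pieces times the size of a net is at most `n ^ (143 k d)`. -/
lemma net_count_le {n k d D : ℕ} (hn : 2 ≤ n) (hk : 1 ≤ k) (hd : 1 ≤ d) (hD : D ≤ 2 * k + 1) :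
    ((n + 1) ^ (k * d)) ^ 2 * ((16 * n * 2 ^ 40 + 1) ^ D + 1) ≤ n ^ (143 * (k * d)) := by
  have hkd : k ≤ k * d := Nat.le_mul_of_pos_right k hd
  have hn1 : 1 ≤ n := by omega
  have h1 : n + 1 ≤ n ^ 2 := by nlinarith
  have h2 : 16 * n * 2 ^ 40 + 1 ≤ n ^ 46 := by
    calc 16 * n * 2 ^ 40 + 1 ≤ 2 ^ 45 * n := by omega
      _ ≤ n ^ 45 * n := by gcongr
      _ = n ^ 46 := by ring
  have h3 : (16 * n * 2 ^ 40 + 1) ^ D ≤ n ^ (138 * (k * d)) := by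
    calc _ ≤ (n ^ 46) ^ D := by gcongr
      _ = n ^ (46 * D) := by rw [pow_mul]
      _ ≤ n ^ (138 * (k * d)) := Nat.pow_le_pow_right hn1 (by omega)
  have h4 : 1 ≤ n ^ (138 * (k * d)) := Nat.one_le_pow _ _ hn1
  -- `143 = 4 + 138 + 1`: pairs of pieces, the grid (`46 · 3`, from `2 k + 1 ≤ 3 k`), and a factor
  -- `2 ≤ n`.
  calc _ ≤ ((n ^ 2) ^ (k * d)) ^ 2 * (n ^ (138 * (k * d)) + n ^ (138 * (k * d))) := by gcongr
    _ = n ^ (4 * (k * d)) * (2 * n ^ (138 * (k * d))) := by ring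
    _ ≤ n ^ (4 * (k * d)) * (n ^ (k * d) * n ^ (138 * (k * d))) := by
        gcongr
        calc 2 ≤ n ^ 1 := by simpa
          _ ≤ n ^ (k * d) := Nat.pow_le_pow_right hn1 (by omega)
    _ = n ^ (143 * (k * d)) := by ring

/-! ### Union bound over the pieces of the network -/

section Network

variable {Ω : Type*} [MeasurableSpace Ω] {μ : Measure Ω} [IsProbabilityMeasure μ]
  {k d n m M b : ℕ} {A : Ω → Matrix (Fin m) (Fin n) ℝ} {C : ℝ} {B : Fin M → Finset (Fin m)}

/-- The main case: input dimension at least one and output dimension at least two. -/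
lemma exists_bad_event_network_of_two_le (hA : IsHeavyTailedMatrix μ A C) (hC : 0 < C)
    (hB : IsBatching b B) (hb : 2 ^ 81 * C ^ 4 ≤ (b : ℝ)) (hn : 2 ≤ n) (hk : 1 ≤ k)
    (hM : 143 * k * d * Real.log n ≤ M) {G : Vec k → Vec n} (hG : IsReLUNetwork n d k n G) :
    ∃ N : Set Ω, μ.real N ≤ Real.exp (-M) ∧
      ∀ ω, ω ∉ N → ∀ z₁ z₂, MostBatchesLarge b B (A ω) (G z₁ - G z₂) := by
  classical
  obtain ⟨Φ, hΦ, hcov⟩ := hG.exists_affine_cover le_rfl (AffineMap.id ℝ (Vec k))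
  choose N hN hgood using fun V : Submodule ℝ (Vec n) =>
    exists_bad_event_subspace hA hC hB hb V
  refine ⟨⋃ φ ∈ Φ ×ˢ Φ, N (differenceSpan φ.1 φ.2), ?_, fun ω hω z₁ z₂ => ?_⟩
  · have hn1 : 1 ≤ n := by omega
    have hle : ∀ φ ∈ Φ ×ˢ Φ, μ.real (N (differenceSpan φ.1 φ.2)) ≤
        ((16 * n * 2 ^ 40 + 1) ^ (2 * k + 1) + 1 : ℕ) * Real.exp (-(2 * M)) := by
      intro φ _
      refine (hN _).trans ?_
      gcongr
      · omega
      · exact finrank_differenceSpan_le _ _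
    have hcount : (Φ ×ˢ Φ).card * ((16 * n * 2 ^ 40 + 1) ^ (2 * k + 1) + 1) ≤
        n ^ (143 * (k * d)) := by
      refine le_trans ?_ (net_count_le hn hk hG.one_le_depth (le_refl (2 * k + 1)))
      rw [Finset.card_product, ← sq]
      gcongr
    have hexp : ((n ^ (143 * (k * d)) : ℕ) : ℝ) ≤ Real.exp M := by
      have hn0 : (0 : ℝ) < n := by exact_mod_cast hn1
      push_cast
      rw [← Real.exp_log hn0, ← Real.exp_nat_mul]
      gcongr
      push_cast
      linarith
    calc _ ≤ ∑ φ ∈ Φ ×ˢ Φ, μ.real (N (differenceSpan φ.1 φ.2)) :=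
          measureReal_biUnion_finset_le _ _
      _ ≤ (Φ ×ˢ Φ).card • (((16 * n * 2 ^ 40 + 1) ^ (2 * k + 1) + 1 : ℕ) *
          Real.exp (-(2 * M))) := Finset.sum_le_card_nsmul _ _ _ hle
      _ = (((Φ ×ˢ Φ).card * ((16 * n * 2 ^ 40 + 1) ^ (2 * k + 1) + 1) : ℕ) : ℝ) *
          Real.exp (-(2 * M)) := by rw [nsmul_eq_mul, ← mul_assoc, ← Nat.cast_mul]
      _ ≤ Real.exp M * Real.exp (-(2 * M)) := by
          gcongr
          exact le_trans (by exact_mod_cast hcount) hexp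
      _ = Real.exp (-M) := by rw [← Real.exp_add]; ring_nf
  · obtain ⟨φ, hφ, e₁⟩ := hcov z₁
    obtain ⟨ψ, hψ, e₂⟩ := hcov z₂
    rw [AffineMap.id_apply] at e₁ e₂
    rw [e₁, e₂]
    refine hgood _ ω (fun h => hω ?_) _ (sub_mem_differenceSpan φ ψ z₁ z₂)
    exact Set.mem_biUnion (x := (φ, ψ)) (Finset.mem_product.2 ⟨hφ, hψ⟩) h

/-- For `n ≤ 1` the logarithm is zero and `hM` gives nothing, but all differences are multiples of
one vector. For `k = 0` all differences vanish. -/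
lemma exists_bad_event_network (hA : IsHeavyTailedMatrix μ A C) (hC : 0 < C)
    (hB : IsBatching b B) (hb : 2 ^ 81 * C ^ 4 ≤ (b : ℝ))
    (hM : 143 * k * d * Real.log n ≤ M) {G : Vec k → Vec n} (hG : IsReLUNetwork n d k n G) :
    ∃ N : Set Ω, μ.real N ≤ Real.exp (-M) ∧
      ∀ ω, ω ∉ N → ∀ z₁ z₂, MostBatchesLarge b B (A ω) (G z₁ - G z₂) := by
  rcases Nat.lt_or_ge n 2 with hn | hn
  · obtain ⟨v, hv⟩ : ∃ v : Vec n, ∀ u : Vec n, ∃ r : ℝ, u = r • v := by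
      refine ⟨WithLp.toLp 2 fun _ => 1, fun u => ?_⟩
      rcases (by omega : n = 0 ∨ n = 1) with rfl | rfl
      · exact ⟨0, Subsingleton.elim _ _⟩
      · refine ⟨u 0, ?_⟩
        ext i
        fin_cases i
        simp
    obtain ⟨N, hN, h⟩ := exists_bad_event_vector hA hC hB hb v
    refine ⟨N, hN.trans (Real.exp_le_exp.2 ?_), fun ω hω z₁ z₂ => ?_⟩
    · have : (0 : ℝ) ≤ M := M.cast_nonneg
      linarith
    · obtain ⟨r, hr⟩ := hv (G z₁ - G z₂)
      rw [hr]
      exact (h ω hω).smul r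
  · rcases Nat.eq_zero_or_pos k with rfl | hk
    · refine ⟨∅, by simpa using (Real.exp_pos _).le, fun ω _ z₁ z₂ => ?_⟩
      rw [Subsingleton.elim z₁ z₂, sub_self]
      exact mostBatchesLarge_zero _
    · exact exists_bad_event_network_of_two_le hA hC hB hb hn hk hM hG

end Network

theorem mainTheorem3 :
    ∃ c₁ : ℝ, 0 < c₁ ∧ ∀ C : ℝ, 0 < C → ∃ γ : ℝ, 0 < γ ∧
      ∀ c₂ : ℝ, c₁ ≤ c₂ → ∃ K c : ℝ, 0 < K ∧ 0 < c ∧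
        ∀ (k d n m M b : ℕ), c₁ * C ^ 4 ≤ b → (b : ℝ) ≤ c₂ * C ^ 4 →
          K * k * d * Real.log n ≤ M →
          ∀ (G : Vec k → Vec n), IsReLUNetwork n d k n G →
          ∀ (B : Fin M → Finset (Fin m)), IsBatching b B →
          ∀ (Ω : Type*) [MeasurableSpace Ω] (μ : Measure Ω) [IsProbabilityMeasure μ]
            (A : Ω → Matrix (Fin m) (Fin n) ℝ), IsHeavyTailedMatrix μ A C →
            1 - Real.exp (-(c * m)) ≤
              μ.real {ω | ∀ z₁ z₂ : Vec k, ∃ J : Finset (Fin M), 0.9 * (M : ℝ) ≤ J.card ∧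
                ∀ j ∈ J, γ ^ 2 * ‖G z₁ - G z₂‖ ^ 2 ≤
                  1 / (b : ℝ) *
                    ‖Matrix.toEuclideanLin (batchMatrix (A ω) (B j)) (G z₁ - G z₂)‖ ^ 2} := by
  refine ⟨2 ^ 81, by positivity, fun C hC => ⟨1 / 8, by norm_num, fun c₂ hc₂ =>
    ⟨143, 1 / (c₂ * C ^ 4), by norm_num, ?_, ?_⟩⟩⟩
  · have : 0 < c₂ := lt_of_lt_of_le (by positivity) hc₂
    positivity
  intro k d n m M b hb hb' hM G hG B hB Ω _ μ _ A hA
  obtain ⟨N, hN, h⟩ := exists_bad_event_network hA hC hB hb hM hG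
  have hc₂ : 0 < c₂ * C ^ 4 := mul_pos (lt_of_lt_of_le (by positivity) hc₂) (by positivity)
  -- The batches cover `[m]`, so `m ≤ M b ≤ M c₂ C⁴`; this dictates the choice of `c`.
  have hm : 1 / (c₂ * C ^ 4) * m ≤ M := by
    rw [one_div_mul_eq_div, div_le_iff₀ hc₂]
    calc (m : ℝ) ≤ M * b := by exact_mod_cast hB.card_le
      _ ≤ M * (c₂ * C ^ 4) := by gcongr
  have hNm : μ.real N ≤ Real.exp (-(1 / (c₂ * C ^ 4) * m)) :=
    hN.trans (Real.exp_le_exp.2 (neg_le_neg hm))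
  -- Subadditivity avoids any measurability of the good event, an intersection over uncountably many
  -- pairs.
  have huniv : (1 : ℝ) ≤ μ.real N +
      μ.real {ω | ∀ z₁ z₂, MostBatchesLarge b B (A ω) (G z₁ - G z₂)} := by
    rw [← probReal_univ (μ := μ)]
    refine le_trans (measureReal_mono fun ω _ => ?_) (measureReal_union_le _ _)
    by_cases hω : ω ∈ N
    · exact Or.inl hω
    · exact Or.inr (h ω hω)
  have hgoal : 1 - Real.exp (-(1 / (c₂ * C ^ 4) * m)) ≤
      μ.real {ω | ∀ z₁ z₂, MostBatchesLarge b B (A ω) (G z₁ - G z₂)} := by linarith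
  exact hgoal
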